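/- **Theorem 5.1.** Let $\mu,p_0>0$ and consider the Chaplygin gas system $$\rho_t+(\rho u)_x=0,\qquad (\rho u)_t+(\rho u^2+p)_x=0,\qquad p=p_0-\frac{\mu^2}{\rho},$$ with initial data $\rho(0,x)=\rho_0(x)$, $u(0,x)=u_0(x)$, where $\rho_0,u_0:\mathbb R\to\mathbb R$ are $C^2$ with bounded $C^2$ norm. Put $\Lambda_\pm=u_0\pm\mu/\rho_0$ and suppose (H1) $\Lambda_-(x)<\Lambda_+(x)$ for all $x\in\mathbb R$; (H2) $\Lambda_-'(x)<0$ and $\Lambda_+'(x)<0$ for all $x\in\mathbb R$. Let $\Sigma=\{(\alpha,\beta):\alpha<\beta,\ \Lambda_-(\alpha)=\Lambda_+(\beta)\}$, $\beta(\alpha)=\Lambda_+^{-1}(\Lambda_-(\alpha))$ and $$f(\alpha)=\frac{\Lambda_-'(\alpha)}{\Lambda_+(\beta(\alpha))-\Lambda_-(\beta(\alpha))}-\frac{\Lambda_+'(\beta(\alpha))}{\Lambda_+(\alpha)-\Lambda_-(\alpha)},$$ and suppose that $\alpha_0<\beta_0$ satisfy (H3) $\Lambda_-(\alpha_0)=\Lambda_+(\beta_0)$;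 (H4) $f(\alpha_0)=0$; (H5) $f'(\alpha_0)<0$. For $\alpha\le\beta$ let $$t(\alpha,\beta)=\int_\alpha^\beta\frac{d\zeta}{\Lambda_+(\zeta)-\Lambda_-(\zeta)},\qquad x(\alpha,\beta)=\frac12\Big\{\alpha+\beta+\int_\alpha^\beta\frac{\Lambda_+(\zeta)+\Lambda_-(\zeta)}{\Lambda_+(\zeta)-\Lambda_-(\zeta)}\,d\zeta\Big\},$$ and put $t_0=t(\alpha_0,\beta_0)$, $x_0=x(\alpha_0,\beta_0)$. Suppose that $t_0$ is the first blowup time, i.e. $t_0\le t(\alpha,\beta)$ for all $(\alpha,\beta)\in\Sigma$. Then every $(t,x)$ with $0\le t<t_0$ equals $(t(\alpha,\beta),x(\alpha,\beta))$ for exactly one pair $\alpha\le\beta$, and the functions built by characteristics, $$\rho(t,x)=\frac{2\mu}{\Lambda_+(\beta)-\Lambda_-(\alpha)},\qquad u(t,x)=\frac{\Lambda_+(\beta)+\Lambda_-(\alpha)}2,$$ form a $C^1$ solution, with $\rho>0$, of the Cauchy problem in $0\le t<t_0$, and $\rho(t,x)\to+\infty$ as $(t,x)\to(t_0,x_0)$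 with $0\le t<t_0$. Moreover the solution satisfies the following condition in the strip $0\le t\le t_0$ (on the line $t=t_0$, a null set, the values of $\rho,u$ are irrelevant): for every $C^1$ function $\phi$ on $\{t\ge0\}$ vanishing outside a compact set, with $D_\varepsilon=\{(t,x):|t-t_0|\le\varepsilon,\ |x-x_0|\le\varepsilon,\ 0\le t\le t_0\}$, the integrals $$\iint_{D_\varepsilon}(\rho\phi_t+\rho u\phi_x)\,dx\,dt\qquad\text{and}\qquad\iint_{D_\varepsilon}\big(\rho u\phi_t+(\rho u^2+p)\phi_x\big)\,dx\,dt$$ converge absolutely for every $\varepsilon>0$ and tend to $0$ as $\varepsilon\to0^+$. -/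

import Mathlib

open MeasureTheory Filter Topology Set

noncomputable section

namespace Chaplygin

/-! Points of the space-time plane are pairs `(t, x)`; characteristic parameters are pairs `(α, β)`. -/

/-- A twice continuously differentiable function with bounded `C²` norm on the line. -/
def BoundedC2 (g : ℝ → ℝ) : Prop :=
  ContDiff ℝ 2 g ∧ ∃ C : ℝ, ∀ k : ℕ, k ≤ 2 → ∀ x : ℝ, |iteratedDeriv k g x| ≤ C

/-- Initial value `u₀ - μ / ρ₀` of the Riemann invariant `λ₋ = u - c`, where `c = μ / ρ`. -/
def initMinus (μ : ℝ) (ρ₀ u₀ : ℝ → ℝ) (x : ℝ) : ℝ := u₀ x - μ / ρ₀ x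

/-- Initial value `u₀ + μ / ρ₀` of the Riemann invariant `λ₊ = u + c`, where `c = μ / ρ`. -/
def initPlus (μ : ℝ) (ρ₀ u₀ : ℝ → ℝ) (x : ℝ) : ℝ := u₀ x + μ / ρ₀ x

/-- Time at which the characteristic of speed `λ₊` issued from `(0, α)` meets the characteristic
of speed `λ₋` issued from `(0, β)`. -/
def charTime (Lm Lp : ℝ → ℝ) (α β : ℝ) : ℝ := ∫ ζ in α..β, 1 / (Lp ζ - Lm ζ)

/-- Position at which these two characteristics meet. -/
def charPos (Lm Lp : ℝ → ℝ) (α β : ℝ) : ℝ :=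
  (1 / 2) * (α + β + ∫ ζ in α..β, (Lp ζ + Lm ζ) / (Lp ζ - Lm ζ))

/-- The map from characteristic parameters `(α, β)` to space-time points `(t, x)`. -/
def charMap (Lm Lp : ℝ → ℝ) (q : ℝ × ℝ) : ℝ × ℝ := (charTime Lm Lp q.1 q.2, charPos Lm Lp q.1 q.2)

/-- Characteristic parameters `(α, β)`, `α ≤ β`, of a space-time point. -/
def charParam (Lm Lp : ℝ → ℝ) (z : ℝ × ℝ) : ℝ × ℝ :=
  Function.invFunOn (charMap Lm Lp) {q : ℝ × ℝ | q.1 ≤ q.2} z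

/-- Density given by the method of characteristics: `λ₋` and `λ₊` keep their initial values
`Λ₋(α)` and `Λ₊(β)`, and `ρ = 2 μ / (λ₊ - λ₋)`. -/
def charDensity (μ : ℝ) (Lm Lp : ℝ → ℝ) (z : ℝ × ℝ) : ℝ :=
  2 * μ / (Lp (charParam Lm Lp z).2 - Lm (charParam Lm Lp z).1)

/-- Velocity given by the method of characteristics: `u = (λ₊ + λ₋) / 2`. -/
def charVelocity (Lm Lp : ℝ → ℝ) (z : ℝ × ℝ) : ℝ :=
  (Lp (charParam Lm Lp z).2 + Lm (charParam Lm Lp z).1) / 2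

/-- The set `Σ` of pairs `α < β` with `Λ₋(α) = Λ₊(β)`. -/
def singularSet (Lm Lp : ℝ → ℝ) : Set (ℝ × ℝ) := {q | q.1 < q.2 ∧ Lm q.1 = Lp q.2}

/-- `β(α) = Λ₊⁻¹(Λ₋(α))`. -/
def betaOf (Lm Lp : ℝ → ℝ) (α : ℝ) : ℝ := Function.invFun Lp (Lm α)

/-- `f(α) = Λ₋'(α) / (Λ₊(β(α)) - Λ₋(β(α))) - Λ₊'(β(α)) / (Λ₊(α) - Λ₋(α))`. -/
def cuspFun (Lm Lp : ℝ → ℝ) (α : ℝ) : ℝ :=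
  deriv Lm α / (Lp (betaOf Lm Lp α) - Lm (betaOf Lm Lp α))
    - deriv Lp (betaOf Lm Lp α) / (Lp α - Lm α)

/-- The Chaplygin (von Kármán–Tsien) pressure law. -/
def pressure (p₀ μ r : ℝ) : ℝ := p₀ - μ ^ 2 / r

/-- The half-open strip `0 ≤ t < T`. -/
def openStrip (T : ℝ) : Set (ℝ × ℝ) := {z | 0 ≤ z.1 ∧ z.1 < T}

/-- The closed strip `0 ≤ t ≤ T`. -/
def strip (T : ℝ) : Set (ℝ × ℝ) := {z | 0 ≤ z.1 ∧ z.1 ≤ T}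

/-- `(ρ, u)` is a classical solution, with positive density, on `0 ≤ t < T` of the Chaplygin gas
system `ρ_t + (ρ u)_x = 0`, `(ρ u)_t + (ρ u² + p)_x = 0` with initial values `ρ₀, u₀`. -/
structure IsClassicalSolution (p₀ μ : ℝ) (ρ₀ u₀ : ℝ → ℝ) (T : ℝ) (ρ u : ℝ × ℝ → ℝ) : Prop where
  density_pos : ∀ z ∈ openStrip T, 0 < ρ z
  contDiffOn_density : ContDiffOn ℝ 1 ρ (openStrip T)
  contDiffOn_velocity : ContDiffOn ℝ 1 u (openStrip T)
  init_density : ∀ x : ℝ, ρ (0, x) = ρ₀ x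
  init_velocity : ∀ x : ℝ, u (0, x) = u₀ x
  mass : ∀ t x : ℝ, 0 < t → t < T →
    deriv (fun s => ρ (s, x)) t + deriv (fun y => ρ (t, y) * u (t, y)) x = 0
  momentum : ∀ t x : ℝ, 0 < t → t < T →
    deriv (fun s => ρ (s, x) * u (s, x)) t
      + deriv (fun y => ρ (t, y) * u (t, y) ^ 2 + pressure p₀ μ (ρ (t, y))) x = 0

/-- Test functions: `C¹` on the closed half plane `t ≥ 0`, vanishing outside a compact set. -/
def IsTestFunction (φ : ℝ × ℝ → ℝ) : Prop :=
  ContDiffOn ℝ 1 φ {z | 0 ≤ z.1} ∧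
    ∃ K : Set (ℝ × ℝ), IsCompact K ∧ ∀ z : ℝ × ℝ, 0 ≤ z.1 → z ∉ K → φ z = 0

/-- The partial derivative `φ_t`. -/
def partialT (φ : ℝ × ℝ → ℝ) (z : ℝ × ℝ) : ℝ := deriv (fun s => φ (s, z.2)) z.1

/-- The partial derivative `φ_x`. -/
def partialX (φ : ℝ × ℝ → ℝ) (z : ℝ × ℝ) : ℝ := deriv (fun y => φ (z.1, y)) z.2

/-- The square `|t - t₀| ≤ ε`, `|x - x₀| ≤ ε`. -/
def square (t₀ x₀ ε : ℝ) : Set (ℝ × ℝ) := {z | |z.1 - t₀| ≤ ε ∧ |z.2 - x₀| ≤ ε}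

/-- For the scalar conservation law `w_t + g_x = 0` considered in the strip `0 ≤ t ≤ t₀`: for every
test function `φ`, the integrals of `w φ_t + g φ_x` over the parts in the strip of the squares
around `(t₀, x₀)` converge, and they tend to zero as the squares shrink. -/
def NegligibleAt (t₀ x₀ : ℝ) (w g : ℝ × ℝ → ℝ) : Prop :=
  ∀ φ : ℝ × ℝ → ℝ, IsTestFunction φ →
    (∀ ε : ℝ, 0 < ε →
      IntegrableOn (fun z => w z * partialT φ z + g z * partialX φ z)
        (square t₀ x₀ ε ∩ strip t₀)) ∧
    Tendsto (fun ε : ℝ => ∫ z in square t₀ x₀ ε ∩ strip t₀,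
      (w z * partialT φ z + g z * partialX φ z)) (𝓝[>] 0) (𝓝 0)

end Chaplygin

end

open Chaplygin

/-! Let `V` invert the Lagrangian coordinate `charTime Lm Lp 0`. The pairs meeting at time `t` are
`(V a, V (a + t))`, and along this curve the position has derivative `Λ₊(β) - Λ₋(α)`. An
intermediate value argument makes this gap positive before the first singular time
(`minus_lt_plus`). Positions stay within bounded distance of `α`, so each time level is covered
exactly once (`existsUnique_param`).

The Jacobian of `charMap` is minus the gap times the weights `1 / (Λ₊ - Λ₋)` at `α` and `β`. Hence
the inverse is `C¹`, and the transport equations for `λ₋`, `λ₊` give both conservation laws. At the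
blowup time the position is still monotone along the level, so the gap vanishes at every parameter
of the blowup point; compactness then gives `ρ → ∞`.

In characteristic parameters the gap in the Jacobian cancels the denominator of `ρ`, so `ρ` is
locally integrable up to the blowup time. Velocity and pressure are bounded, so all fluxes are
integrable, and absolute continuity of the integral gives the limit condition. -/

namespace Chaplygin

/-- `C¹` initial Riemann invariants that are bounded by `K` and separated by at least `c > 0`. -/
structure SeparatedInvariants (c K : ℝ) (Lm Lp : ℝ → ℝ) : Prop where
  contDiff_minus : ContDiff ℝ 1 Lm
  contDiff_plus : ContDiff ℝ 1 Lp
  pos : 0 < c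
  gap : ∀ x, c ≤ Lp x - Lm x
  bound_minus : ∀ x, |Lm x| ≤ K
  bound_plus : ∀ x, |Lp x| ≤ K

theorem contDiff_one_of_hasDerivAt {f f' : ℝ → ℝ} (h : ∀ x, HasDerivAt f (f' x) x)
    (hc : Continuous f') : ContDiff ℝ 1 f := by
  rw [contDiff_one_iff_deriv]
  refine ⟨fun x => (h x).differentiableAt, ?_⟩
  rwa [show deriv f = f' from funext fun x => (h x).deriv]

theorem charTime_self (Lm Lp : ℝ → ℝ) (α : ℝ) : charTime Lm Lp α α = 0 :=
  intervalIntegral.integral_same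

/-- The two bounded monotone invariants are controlled by their mean. -/
theorem abs_le_of_antitone_of_mean_bounded {Lm Lp : ℝ → ℝ} {C : ℝ} (hm : Antitone Lm)
    (hp : Antitone Lp) (hlt : ∀ x, Lm x < Lp x) (hC : ∀ x, |(Lp x + Lm x) / 2| ≤ C) (x : ℝ) :
    |Lm x| ≤ 2 * C + |Lm 0| + |Lp 0| ∧ |Lp x| ≤ 2 * C + |Lm 0| + |Lp 0| := by
  have h1 := abs_le.1 (hC x)
  have h2 := hlt x
  have a1 := neg_abs_le (Lm 0)
  have a2 := le_abs_self (Lm 0)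
  have a3 := neg_abs_le (Lp 0)
  have a4 := le_abs_self (Lp 0)
  rw [abs_le, abs_le]
  rcases le_total x 0 with h | h
  -- Left of `0` both invariants lie above their values at `0`, so a bounded mean bounds each from
  -- above; right of `0` the roles are exchanged.
  · have h3 := hm h
    have h4 := hp h
    refine ⟨⟨?_, ?_⟩, ?_, ?_⟩ <;> linarith
  · have h3 := hm h
    have h4 := hp h
    refine ⟨⟨?_, ?_⟩, ?_, ?_⟩ <;> linarith

/-! ### Characteristic time and position through functions of one variable -/

namespace SeparatedInvariants

variable {c K : ℝ} {Lm Lp : ℝ → ℝ}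

section

variable (S : SeparatedInvariants c K Lm Lp)
include S

theorem gap_pos (x : ℝ) : 0 < Lp x - Lm x := S.pos.trans_le (S.gap x)

theorem gap_ne (x : ℝ) : Lp x - Lm x ≠ 0 := (S.gap_pos x).ne'

theorem gap_le (x : ℝ) : Lp x - Lm x ≤ 2 * K := by
  have h1 := abs_le.1 (S.bound_minus x)
  have h2 := abs_le.1 (S.bound_plus x)
  linarith

theorem bound_pos : 0 < K := by
  have h1 := S.gap_pos 0
  have h2 := S.gap_le 0
  linarith

theorem continuous_weight : Continuous fun x => 1 / (Lp x - Lm x) :=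
  continuous_const.div (S.contDiff_plus.continuous.sub S.contDiff_minus.continuous) S.gap_ne

theorem continuous_ratio : Continuous fun x => (Lp x + Lm x) / (Lp x - Lm x) :=
  (S.contDiff_plus.continuous.add S.contDiff_minus.continuous).div
    (S.contDiff_plus.continuous.sub S.contDiff_minus.continuous) S.gap_ne

theorem charTime_eq (α β : ℝ) :
    charTime Lm Lp α β = charTime Lm Lp 0 β - charTime Lm Lp 0 α :=
  (intervalIntegral.integral_interval_sub_left (S.continuous_weight.intervalIntegrable _ _)
    (S.continuous_weight.intervalIntegrable _ _)).symm

theorem charPos_eq (α β : ℝ) :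
    charPos Lm Lp α β = charPos Lm Lp 0 β - charPos Lm Lp 0 α + α := by
  have h := intervalIntegral.integral_interval_sub_left
    (S.continuous_ratio.intervalIntegrable (μ := volume) 0 β)
    (S.continuous_ratio.intervalIntegrable 0 α)
  simp only [charPos]
  rw [← h]
  ring

theorem hasDerivAt_charTime (x : ℝ) :
    HasDerivAt (charTime Lm Lp 0) (1 / (Lp x - Lm x)) x :=
  (S.continuous_weight.integral_hasStrictDerivAt 0 x).hasDerivAt

/-- Half of `1 + (Λ₊ + Λ₋) / (Λ₊ - Λ₋)` is `Λ₊ / (Λ₊ - Λ₋)`. -/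
theorem hasDerivAt_charPos (x : ℝ) :
    HasDerivAt (charPos Lm Lp 0) (Lp x * (1 / (Lp x - Lm x))) x := by
  have h := (((hasDerivAt_id x).const_add 0).add
    (S.continuous_ratio.integral_hasStrictDerivAt 0 x).hasDerivAt).const_mul (1 / 2)
  convert! h using 1
  have := S.gap_ne x
  field_simp
  ring

theorem contDiff_charTime : ContDiff ℝ 1 (charTime Lm Lp 0) :=
  contDiff_one_of_hasDerivAt S.hasDerivAt_charTime S.continuous_weight

theorem contDiff_charPos : ContDiff ℝ 1 (charPos Lm Lp 0) :=
  contDiff_one_of_hasDerivAt S.hasDerivAt_charPos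
    (S.contDiff_plus.continuous.mul S.continuous_weight)

theorem charMap_eq : charMap Lm Lp = fun q => (charTime Lm Lp 0 q.2 - charTime Lm Lp 0 q.1,
    charPos Lm Lp 0 q.2 - charPos Lm Lp 0 q.1 + q.1) := by
  funext q
  rw [charMap, S.charTime_eq, S.charPos_eq]

theorem contDiff_charMap : ContDiff ℝ 1 (charMap Lm Lp) := by
  rw [S.charMap_eq]
  have h1 := S.contDiff_charTime
  have h2 := S.contDiff_charPos
  fun_prop

theorem strictMono_charTime : StrictMono (charTime Lm Lp 0) :=
  strictMono_of_deriv_pos fun x => by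
    rw [(S.hasDerivAt_charTime x).deriv]
    exact one_div_pos.2 (S.gap_pos x)

theorem charTime_lt_charTime {α β γ : ℝ} (h : β < γ) :
    charTime Lm Lp α β < charTime Lm Lp α γ := by
  rw [S.charTime_eq α β, S.charTime_eq α γ]
  linarith [S.strictMono_charTime h]

theorem charTime_nonneg_iff {α β : ℝ} : 0 ≤ charTime Lm Lp α β ↔ α ≤ β := by
  rw [S.charTime_eq, sub_nonneg, S.strictMono_charTime.le_iff_le]

/-- The length of the initial segment is controlled by the time. -/
theorem sub_le_charTime {α β : ℝ} (h : α ≤ β) : β - α ≤ 2 * K * charTime Lm Lp α β := by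
  have h1 : (β - α) * (1 / (2 * K)) ≤ charTime Lm Lp α β := by
    have := intervalIntegral.integral_mono_on h (f := fun _ => 1 / (2 * K))
      (g := fun x => 1 / (Lp x - Lm x)) intervalIntegrable_const
      (S.continuous_weight.intervalIntegrable (μ := volume) _ _)
      (fun x _ => one_div_le_one_div_of_le (S.gap_pos x) (S.gap_le x))
    rwa [intervalIntegral.integral_const, smul_eq_mul] at this
  have hK := S.bound_pos
  rw [mul_one_div, div_le_iff₀ (by positivity)] at h1
  linarith

/-- The integrand is at most `2K / c` and the interval has length at most `2K` times the time. This
uniform bound on the displacement makes each time level cover the line and confines parameters to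
compact sets. -/
theorem abs_charPos_sub_le {α β : ℝ} (h : α ≤ β) :
    |charPos Lm Lp α β - α| ≤ (1 + 2 * K / c) * (2 * K * charTime Lm Lp α β) := by
  have hK := S.bound_pos
  have hc := S.pos
  have h1 : ‖∫ ζ in α..β, (Lp ζ + Lm ζ) / (Lp ζ - Lm ζ)‖ ≤ 2 * K / c * |β - α| := by
    refine intervalIntegral.norm_integral_le_of_norm_le_const fun x _ => ?_
    rw [Real.norm_eq_abs, abs_div, abs_of_pos (S.gap_pos x)]
    refine div_le_div₀ (by positivity) ?_ hc (S.gap x)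
    have := abs_add_le (Lp x) (Lm x)
    linarith [S.bound_minus x, S.bound_plus x]
  rw [Real.norm_eq_abs, abs_of_nonneg (sub_nonneg.2 h)] at h1
  have h2 : |charPos Lm Lp α β - α| ≤ (1 + 2 * K / c) * (β - α) := by
    rw [show charPos Lm Lp α β - α =
      (1 / 2) * ((β - α) + ∫ ζ in α..β, (Lp ζ + Lm ζ) / (Lp ζ - Lm ζ)) by rw [charPos]; ring,
      abs_mul, abs_of_pos (by norm_num : (0 : ℝ) < 1 / 2)]
    have h3 := abs_add_le (β - α) (∫ ζ in α..β, (Lp ζ + Lm ζ) / (Lp ζ - Lm ζ))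
    rw [abs_of_nonneg (sub_nonneg.2 h)] at h3
    have h4 : 0 ≤ (1 + 2 * K / c) * (β - α) := mul_nonneg (by positivity) (sub_nonneg.2 h)
    linarith
  exact h2.trans (mul_le_mul_of_nonneg_left (S.sub_le_charTime h) (by positivity))

theorem surjective_charTime : Function.Surjective (charTime Lm Lp 0) := by
  have hK := S.bound_pos
  intro t
  -- The time grows at rate at least `1 / (2K)`, so it has reached `t` at the points `±2K|t|`.
  refine mem_range_of_exists_le_of_exists_ge S.contDiff_charTime.continuous
    ⟨-(2 * K * |t|), ?_⟩ ⟨2 * K * |t|, ?_⟩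
  · have h := S.sub_le_charTime (α := -(2 * K * |t|)) (β := 0) (by simp; positivity)
    rw [S.charTime_eq, charTime_self] at h
    have := neg_abs_le t
    have h2 : 2 * K * |t| ≤ 2 * K * (0 - charTime Lm Lp 0 (-(2 * K * |t|))) := by linarith
    have := le_of_mul_le_mul_left h2 (by positivity)
    linarith
  · have h := S.sub_le_charTime (α := 0) (β := 2 * K * |t|) (by positivity)
    have := le_abs_self t
    have h2 : 2 * K * |t| ≤ 2 * K * (charTime Lm Lp 0 (2 * K * |t|)) := by linarith
    have := le_of_mul_le_mul_left h2 (by positivity)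
    linarith

/-- The Lagrangian coordinate `charTime Lm Lp 0` has a differentiable inverse. -/
theorem exists_inverse : ∃ V : ℝ → ℝ, (∀ s, charTime Lm Lp 0 (V s) = s) ∧
    (∀ x, V (charTime Lm Lp 0 x) = x) ∧ ∀ s, HasDerivAt V (Lp (V s) - Lm (V s)) s := by
  let e := S.strictMono_charTime.orderIsoOfSurjective _ S.surjective_charTime
  have he : ∀ s, charTime Lm Lp 0 (e.symm s) = s := fun s => e.apply_symm_apply s
  refine ⟨e.symm, he, fun x => e.symm_apply_apply x, fun s => ?_⟩
  have h := HasDerivAt.of_local_left_inverse (g := e.symm) (a := s)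
    e.symm.continuous.continuousAt (S.hasDerivAt_charTime (e.symm s))
    (one_div_pos.2 (S.gap_pos _)).ne' (Eventually.of_forall he)
  simpa using h

/-- Position along a level line of time, as a function of the Lagrangian coordinate. -/
theorem hasDerivAt_charPos_level {V : ℝ → ℝ}
    (hV : ∀ s, HasDerivAt V (Lp (V s) - Lm (V s)) s) (t a : ℝ) :
    HasDerivAt (fun a => charPos Lm Lp (V a) (V (a + t))) (Lp (V (a + t)) - Lm (V a)) a := by
  have h1 : HasDerivAt (fun a => V (a + t)) (Lp (V (a + t)) - Lm (V (a + t))) a :=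
    HasDerivAt.comp_add_const a t (hV (a + t))
  have h := (((S.hasDerivAt_charPos (V (a + t))).comp a h1).sub
    ((S.hasDerivAt_charPos (V a)).comp a (hV a))).add (hV a)
  have hfun : (fun a => charPos Lm Lp (V a) (V (a + t))) =
      fun a => charPos Lm Lp 0 (V (a + t)) - charPos Lm Lp 0 (V a) + V a :=
    funext fun a => S.charPos_eq _ _
  rw [hfun]
  convert! h using 1
  have g1 := S.gap_ne (V (a + t))
  have g2 := S.gap_ne (V a)
  field_simp
  ring

/-- Places every pair of time `t` on the curve `a ↦ (V a, V (a + t))`, which reduces questions about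
`charMap` to one variable. -/
theorem level_eq {V : ℝ → ℝ} (hV : ∀ x, V (charTime Lm Lp 0 x) = x) {q : ℝ × ℝ} {t : ℝ}
    (h : charTime Lm Lp q.1 q.2 = t) :
    V (charTime Lm Lp 0 q.1) = q.1 ∧ V (charTime Lm Lp 0 q.1 + t) = q.2 := by
  refine ⟨hV _, ?_⟩
  rw [← h, S.charTime_eq q.1, add_sub_cancel, hV]

end

/-! ### Time levels up to the first singular time -/

section Blowup

variable {T : ℝ} (S : SeparatedInvariants c K Lm Lp)
  (hT : ∀ q ∈ singularSet Lm Lp, T ≤ charTime Lm Lp q.1 q.2)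
include S hT

/-- Otherwise `Λ₋(α)` lies between `Λ₊(β)` and `Λ₊(α)`, hence equals `Λ₊(γ)` for some `γ` in `(α,
β]`; then `(α, γ)` is singular with time below `T`. -/
theorem minus_lt_plus {α β : ℝ} (h : α ≤ β) (ht : charTime Lm Lp α β < T) : Lm α < Lp β := by
  by_contra! hle
  have h1 : Lm α ∈ Icc (Lp β) (Lp α) := ⟨hle, by linarith [S.gap_pos α]⟩
  obtain ⟨γ, hγ, hγe⟩ := intermediate_value_Icc' h S.contDiff_plus.continuous.continuousOn h1
  have hne : α ≠ γ := by
    rintro rfl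
    linarith [S.gap_pos α]
  have h2 := hT (α, γ) ⟨lt_of_le_of_ne hγ.1 hne, hγe.symm⟩
  rcases hγ.2.eq_or_lt with rfl | hlt
  · exact (h2.trans_lt ht).false
  · exact ((h2.trans_lt (S.charTime_lt_charTime hlt)).trans ht).false

theorem minus_le_plus {α β : ℝ} (h : α ≤ β) (ht : charTime Lm Lp α β ≤ T) : Lm α ≤ Lp β := by
  rcases h.eq_or_lt with rfl | hlt
  · linarith [S.gap_pos α]
  · have hev : ∀ᶠ γ in 𝓝[<] β, Lm α ≤ Lp γ := by
      filter_upwards [Ioo_mem_nhdsLT hlt] with γ hγ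
      exact (S.minus_lt_plus hT hγ.1.le ((S.charTime_lt_charTime hγ.2).trans_le ht)).le
    exact ge_of_tendsto ((S.contDiff_plus.continuous.tendsto β).mono_left nhdsWithin_le_nhds) hev

theorem existsUnique_param {z : ℝ × ℝ} (hz : z ∈ openStrip T) :
    ∃! q : ℝ × ℝ, q.1 ≤ q.2 ∧ charMap Lm Lp q = z := by
  obtain ⟨V, hWV, hVW, hV⟩ := S.exists_inverse
  obtain ⟨t, x⟩ := z
  obtain ⟨ht0, htT⟩ : 0 ≤ t ∧ t < T := hz
  have htime : ∀ a, charTime Lm Lp (V a) (V (a + t)) = t := fun a => by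
    rw [S.charTime_eq, hWV, hWV]; ring
  have hle : ∀ a, V a ≤ V (a + t) := fun a => S.charTime_nonneg_iff.1 (by rwa [htime])
  have hmono : StrictMono fun a => charPos Lm Lp (V a) (V (a + t)) :=
    strictMono_of_deriv_pos fun a => by
      rw [(S.hasDerivAt_charPos_level hV t a).deriv, sub_pos]
      exact S.minus_lt_plus hT (hle a) (by rwa [htime])
  have hcont : Continuous fun a => charPos Lm Lp (V a) (V (a + t)) :=
    continuous_iff_continuousAt.2 fun a => (S.hasDerivAt_charPos_level hV t a).continuousAt
  have hbd : ∀ a, |charPos Lm Lp (V a) (V (a + t)) - V a| ≤ (1 + 2 * K / c) * (2 * K * t) :=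
    fun a => by simpa [htime] using S.abs_charPos_sub_le (hle a)
  -- The endpoints have `V a` equal to `x` minus and plus the maximal displacement.
  obtain ⟨a, ha⟩ := mem_range_of_exists_le_of_exists_ge (c := x) hcont
    ⟨charTime Lm Lp 0 (x - (1 + 2 * K / c) * (2 * K * t)), by
      have := abs_le.1 (hbd (charTime Lm Lp 0 (x - (1 + 2 * K / c) * (2 * K * t))))
      simp only [hVW] at this ⊢
      linarith⟩
    ⟨charTime Lm Lp 0 (x + (1 + 2 * K / c) * (2 * K * t)), by
      have := abs_le.1 (hbd (charTime Lm Lp 0 (x + (1 + 2 * K / c) * (2 * K * t))))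
      simp only [hVW] at this ⊢
      linarith⟩
  refine ⟨(V a, V (a + t)), ⟨hle a, Prod.ext (htime a) ha⟩, fun q hq => ?_⟩
  obtain ⟨hq1, hq2⟩ := Prod.ext_iff.1 hq.2
  obtain ⟨e1, e2⟩ := S.level_eq hVW hq1
  simp only [charMap] at hq2
  have : charTime Lm Lp 0 q.1 = a := hmono.injective (by
    simp only at e1 e2 ha ⊢
    rw [ha, e1, e2, hq2])
  rw [this] at e1 e2
  exact Prod.ext e1.symm e2.symm

/-- Two parameters of one point at the time `T`, one of them singular, are both singular. -/
theorem eq_of_charMap_eq {q q' : ℝ × ℝ} (hq' : q' ∈ singularSet Lm Lp)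
    (ht : charTime Lm Lp q'.1 q'.2 = T) (h : charMap Lm Lp q = charMap Lm Lp q') :
    Lp q.2 = Lm q.1 := by
  obtain ⟨V, hWV, hVW, hV⟩ := S.exists_inverse
  have hT0 : 0 ≤ T := ht ▸ S.charTime_nonneg_iff.2 hq'.1.le
  obtain ⟨h1, h2⟩ := Prod.ext_iff.1 h
  simp only [charMap] at h1 h2
  obtain ⟨e1, e2⟩ := S.level_eq hVW (h1.trans ht)
  obtain ⟨e1', e2'⟩ := S.level_eq hVW ht
  set a := charTime Lm Lp 0 q.1
  set a' := charTime Lm Lp 0 q'.1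
  have htime : ∀ a, charTime Lm Lp (V a) (V (a + T)) = T := fun a => by
    rw [S.charTime_eq, hWV, hWV]; ring
  have hmono : Monotone fun a => charPos Lm Lp (V a) (V (a + T)) :=
    monotone_of_deriv_nonneg
      (fun a => (S.hasDerivAt_charPos_level hV T a).differentiableAt) fun a => by
      rw [(S.hasDerivAt_charPos_level hV T a).deriv, sub_nonneg]
      exact S.minus_le_plus hT (S.charTime_nonneg_iff.1 (by rwa [htime])) (htime a).le
  have heq : charPos Lm Lp (V a) (V (a + T)) = charPos Lm Lp (V a') (V (a' + T)) := by
    rw [e1, e2, e1', e2', h2]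
  by_contra hne
  rw [← e1, ← e2] at hne
  -- A nonzero derivative at `a` keeps nearby positions different from the one at `a`, whereas a
  -- monotone function with equal values at `a` and `a'` is constant between them.
  have hev := (S.hasDerivAt_charPos_level hV T a).eventually_ne
    (c := charPos Lm Lp (V a) (V (a + T))) (sub_ne_zero.2 hne)
  rcases lt_trichotomy a a' with hlt | he | hlt
  · have hev' := hev.filter_mono (nhdsWithin_mono a fun y (hy : y ∈ Ioi a) => ne_of_gt hy)
    obtain ⟨y, hy, hy'⟩ := (hev'.and (Ioo_mem_nhdsGT hlt)).exists
    exact hy (le_antisymm ((hmono hy'.2.le).trans heq.ge) (hmono hy'.1.le))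
  · rw [he, e1', e2', hq'.2] at hne
    exact hne rfl
  · have hev' := hev.filter_mono (nhdsWithin_mono a fun y (hy : y ∈ Iio a) => ne_of_lt hy)
    obtain ⟨y, hy, hy'⟩ := (hev'.and (Ioo_mem_nhdsLT hlt)).exists
    exact hy (le_antisymm (hmono hy'.2.le) (heq.le.trans (hmono hy'.1.le)))

end Blowup

end SeparatedInvariants

/-! ### Jacobian and conservation laws in Riemann invariants -/

/-- The derivative of `charMap Lm Lp`. -/
noncomputable def charJacobian (Lm Lp : ℝ → ℝ) (q : ℝ × ℝ) : ℝ × ℝ →L[ℝ] ℝ × ℝ :=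
  (Matrix.toLin (.finTwoProd ℝ) (.finTwoProd ℝ)
    !![-(1 / (Lp q.1 - Lm q.1)), 1 / (Lp q.2 - Lm q.2);
      -(Lm q.1 * (1 / (Lp q.1 - Lm q.1))),
      Lp q.2 * (1 / (Lp q.2 - Lm q.2))]).toContinuousLinearMap

theorem det_charJacobian (Lm Lp : ℝ → ℝ) (q : ℝ × ℝ) : (charJacobian Lm Lp q).det =
    -((Lp q.2 - Lm q.1) * (1 / (Lp q.1 - Lm q.1) * (1 / (Lp q.2 - Lm q.2)))) := by
  simp only [charJacobian, LinearMap.det_toContinuousLinearMap, LinearMap.det_toLin,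
    Matrix.det_fin_two_of]
  ring

/-- If the two Riemann invariants satisfy `M_t + P M_x = 0` and `P_t + M P_x = 0`, then
`ρ = 2 μ / (P - M)`, `u = (P + M) / 2` satisfy the equation of conservation of mass. -/
theorem mass_of_invariants {μ m p t x : ℝ} {M P : ℝ × ℝ → ℝ}
    (hMt : HasDerivAt (fun s => M (s, x)) (-(P (t, x) * m)) t)
    (hMx : HasDerivAt (fun y => M (t, y)) m x)
    (hPt : HasDerivAt (fun s => P (s, x)) (-(M (t, x) * p)) t)
    (hPx : HasDerivAt (fun y => P (t, y)) p x) (hne : P (t, x) - M (t, x) ≠ 0) :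
    deriv (fun s => 2 * μ / (P (s, x) - M (s, x))) t +
      deriv (fun y => 2 * μ / (P (t, y) - M (t, y)) * ((P (t, y) + M (t, y)) / 2)) x = 0 := by
  have h1 := (hasDerivAt_const t (2 * μ)).fun_div (hPt.fun_sub hMt) hne
  have h2 := ((hasDerivAt_const x (2 * μ)).fun_div (hPx.fun_sub hMx) hne).fun_mul
    ((hPx.fun_add hMx).div_const 2)
  rw [h1.deriv, h2.deriv]
  field_simp
  ring

/-- Under the same assumptions the momentum is conserved. -/
theorem momentum_of_invariants {μ p₀ m p t x : ℝ} {M P : ℝ × ℝ → ℝ}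
    (hMt : HasDerivAt (fun s => M (s, x)) (-(P (t, x) * m)) t)
    (hMx : HasDerivAt (fun y => M (t, y)) m x)
    (hPt : HasDerivAt (fun s => P (s, x)) (-(M (t, x) * p)) t)
    (hPx : HasDerivAt (fun y => P (t, y)) p x) (hne : P (t, x) - M (t, x) ≠ 0) :
    deriv (fun s => 2 * μ / (P (s, x) - M (s, x)) * ((P (s, x) + M (s, x)) / 2)) t +
      deriv (fun y => 2 * μ / (P (t, y) - M (t, y)) * ((P (t, y) + M (t, y)) / 2) ^ 2 +
        pressure p₀ μ (2 * μ / (P (t, y) - M (t, y)))) x = 0 := by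
  -- The Chaplygin pressure is affine in the gap `D = λ₊ - λ₋`.
  have hp : ∀ D : ℝ, pressure p₀ μ (2 * μ / D) = p₀ - μ / 2 * D := fun D => by
    rw [pressure, div_div_eq_mul_div]
    field_simp
  simp only [hp]
  have h1 := ((hasDerivAt_const t (2 * μ)).fun_div (hPt.fun_sub hMt) hne).fun_mul
    ((hPt.fun_add hMt).div_const 2)
  have h2 := (((hasDerivAt_const x (2 * μ)).fun_div (hPx.fun_sub hMx) hne).fun_mul
    (((hPx.fun_add hMx).div_const 2).fun_pow 2)).fun_add
    (((hPx.fun_sub hMx).const_mul (μ / 2)).const_sub p₀)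
  rw [h1.deriv, h2.deriv]
  field_simp
  ring

theorem openStrip_mem_nhds {T : ℝ} {z : ℝ × ℝ} (h0 : 0 < z.1) (hT : z.1 < T) :
    openStrip T ∈ 𝓝 z := by
  filter_upwards [continuous_fst.continuousAt.eventually (lt_mem_nhds h0),
    continuous_fst.continuousAt.eventually (gt_mem_nhds hT)] with w h1 h2
  exact ⟨h1.le, h2⟩

/-! ### Regularity of the inverse map and the classical solution -/

namespace SeparatedInvariants

variable {c K : ℝ} {Lm Lp : ℝ → ℝ}

theorem hasFDerivAt_charMap (S : SeparatedInvariants c K Lm Lp) (q : ℝ × ℝ) :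
    HasFDerivAt (charMap Lm Lp) (charJacobian Lm Lp q) q := by
  rw [S.charMap_eq, charJacobian, Matrix.toLin_finTwoProd_toContinuousLinearMap]
  have h1 := (S.hasDerivAt_charTime q.2).comp_hasFDerivAt q (hasFDerivAt_snd (𝕜 := ℝ) (p := q))
  have h2 := (S.hasDerivAt_charTime q.1).comp_hasFDerivAt q (hasFDerivAt_fst (𝕜 := ℝ) (p := q))
  have h3 := (S.hasDerivAt_charPos q.2).comp_hasFDerivAt q (hasFDerivAt_snd (𝕜 := ℝ) (p := q))
  have h4 := (S.hasDerivAt_charPos q.1).comp_hasFDerivAt q (hasFDerivAt_fst (𝕜 := ℝ) (p := q))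
  refine ((h1.sub h2).prodMk ((h3.sub h4).add hasFDerivAt_fst)).congr_fderiv ?_
  -- The extra summand `α` in the position turns `-Λ₊ / (Λ₊ - Λ₋)` into `-Λ₋ / (Λ₊ - Λ₋)` at `α`.
  have g1 := S.gap_ne q.1
  ext <;> simp
  field_simp
  ring

variable {T : ℝ} (S : SeparatedInvariants c K Lm Lp)
  (hT : ∀ q ∈ singularSet Lm Lp, T ≤ charTime Lm Lp q.1 q.2)
include S hT

theorem charParam_spec {z : ℝ × ℝ} (hz : z ∈ openStrip T) :
    (charParam Lm Lp z).1 ≤ (charParam Lm Lp z).2 ∧ charMap Lm Lp (charParam Lm Lp z) = z := by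
  obtain ⟨q, hq, -⟩ := S.existsUnique_param hT hz
  have hex : ∃ q ∈ {q : ℝ × ℝ | q.1 ≤ q.2}, charMap Lm Lp q = z := ⟨q, hq⟩
  exact ⟨Function.invFunOn_mem hex, Function.invFunOn_eq hex⟩

/-- The order `q.1 ≤ q.2` need not be assumed: it follows from nonnegative time. -/
theorem charParam_eq {z q : ℝ × ℝ} (hz : z ∈ openStrip T) (hq : charMap Lm Lp q = z) :
    charParam Lm Lp z = q := by
  have hle : q.1 ≤ q.2 := S.charTime_nonneg_iff.1 (by
    have h := hz.1
    rwa [← hq] at h)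
  exact (S.existsUnique_param hT hz).unique (S.charParam_spec hT hz) ⟨hle, hq⟩

theorem charParam_gap_pos {z : ℝ × ℝ} (hz : z ∈ openStrip T) :
    0 < Lp (charParam Lm Lp z).2 - Lm (charParam Lm Lp z).1 := by
  obtain ⟨h1, h2⟩ := S.charParam_spec hT hz
  have h3 := congrArg Prod.fst h2
  exact sub_pos.2 (S.minus_lt_plus hT h1 (h3.trans_lt hz.2))

/-- The inverse function theorem applies since the gap is nonzero, and global uniqueness identifies
the local inverse with `charParam` on the strip. As `charMap` is `C¹` on the whole plane, this
includes the boundary `t = 0`. -/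
theorem contDiffOn_charParam : ContDiffOn ℝ 1 (charParam Lm Lp) (openStrip T) := by
  intro z hz
  have hspec := (S.charParam_spec hT hz).2
  have hdet : (charJacobian Lm Lp (charParam Lm Lp z)).det ≠ 0 := by
    rw [det_charJacobian, neg_ne_zero]
    exact mul_ne_zero (S.charParam_gap_pos hT hz).ne'
      (mul_ne_zero (one_div_ne_zero (S.gap_ne _)) (one_div_ne_zero (S.gap_ne _)))
  have hC : ContDiffAt ℝ 1 (charMap Lm Lp) (charParam Lm Lp z) := S.contDiff_charMap.contDiffAt
  have hF : HasFDerivAt (charMap Lm Lp)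
      ((ContinuousLinearMap.toContinuousLinearEquivOfDetNeZero _ hdet : (ℝ × ℝ) ≃L[ℝ] ℝ × ℝ) :
        ℝ × ℝ →L[ℝ] ℝ × ℝ) (charParam Lm Lp z) := by
    rw [ContinuousLinearMap.coe_toContinuousLinearEquivOfDetNeZero]
    exact S.hasFDerivAt_charMap _
  have hg := hC.to_localInverse hF one_ne_zero
  have hev := (hC.hasStrictFDerivAt' hF one_ne_zero).eventually_right_inverse
  rw [hspec] at hg hev
  have heq : ∀ w ∈ openStrip T,
      charMap Lm Lp (hC.localInverse hF one_ne_zero w) = w →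
      charParam Lm Lp w = hC.localInverse hF one_ne_zero w :=
    fun w hw h => S.charParam_eq hT hw h
  refine hg.contDiffWithinAt.congr_of_eventuallyEq ?_ (heq z hz hev.self_of_nhds)
  filter_upwards [self_mem_nhdsWithin, hev.filter_mono nhdsWithin_le_nhds] with w hw hw'
  exact heq w hw hw'

/-- Derivatives of the Riemann invariants of the constructed solution: `λ₋` is transported with
speed `λ₊`, and `λ₊` with speed `λ₋`. -/
theorem exists_invariant_deriv {t x : ℝ} (h0 : 0 < t) (h1 : t < T) : ∃ m p : ℝ,
    HasDerivAt (fun s => Lm (charParam Lm Lp (s, x)).1)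
      (-(Lp (charParam Lm Lp (t, x)).2 * m)) t ∧
    HasDerivAt (fun y => Lm (charParam Lm Lp (t, y)).1) m x ∧
    HasDerivAt (fun s => Lp (charParam Lm Lp (s, x)).2)
      (-(Lm (charParam Lm Lp (t, x)).1 * p)) t ∧
    HasDerivAt (fun y => Lp (charParam Lm Lp (t, y)).2) p x := by
  have hnhds : openStrip T ∈ 𝓝 (t, x) := openStrip_mem_nhds h0 h1
  have hz : (t, x) ∈ openStrip T := ⟨h0.le, h1⟩
  have hd : DifferentiableAt ℝ (charParam Lm Lp) (t, x) :=
    ((S.contDiffOn_charParam hT).contDiffAt hnhds).differentiableAt one_ne_zero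
  have hlt : HasDerivAt (fun s : ℝ => (s, x)) (1, 0) t :=
    (hasDerivAt_id t).prodMk (hasDerivAt_const t x)
  have hlx : HasDerivAt (fun y : ℝ => (t, y)) (0, 1) x :=
    (hasDerivAt_const x t).prodMk (hasDerivAt_id x)
  have hF := S.hasFDerivAt_charMap (charParam Lm Lp (t, x))
  have hid : HasFDerivAt (fun z => charMap Lm Lp (charParam Lm Lp z))
      (ContinuousLinearMap.id ℝ (ℝ × ℝ)) (t, x) := by
    refine (hasFDerivAt_id (t, x)).congr_of_eventuallyEq ?_
    filter_upwards [hnhds] with z hz using (S.charParam_spec hT hz).2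
  have hcomp := (hF.comp (t, x) hd.hasFDerivAt).unique hid
  set q := charParam Lm Lp (t, x) with hq
  have hgap : Lp q.2 - Lm q.1 ≠ 0 := (S.charParam_gap_pos hT hz).ne'
  have gA := S.gap_ne q.1
  have gB := S.gap_ne q.2
  have hp := hd.hasFDerivAt.comp_hasDerivAt t hlt
  have hpx := hd.hasFDerivAt.comp_hasDerivAt x hlx
  have et := congrArg (fun l => l (1, 0)) hcomp
  have ex := congrArg (fun l => l (0, 1)) hcomp
  set vt := fderiv ℝ (charParam Lm Lp) (t, x) (1, 0)
  set vx := fderiv ℝ (charParam Lm Lp) (t, x) (0, 1)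
  have happ : ∀ v : ℝ × ℝ, charJacobian Lm Lp q v =
      (-(1 / (Lp q.1 - Lm q.1)) * v.1 + 1 / (Lp q.2 - Lm q.2) * v.2,
       -(Lm q.1 * (1 / (Lp q.1 - Lm q.1))) * v.1 +
        Lp q.2 * (1 / (Lp q.2 - Lm q.2)) * v.2) := fun v => by
    rw [charJacobian, Matrix.toLin_finTwoProd_toContinuousLinearMap]
    simp
  have et' : charJacobian Lm Lp q vt = (1, 0) := et
  have ex' : charJacobian Lm Lp q vx = (0, 1) := ex
  rw [happ, Prod.mk.injEq] at et' ex'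
  obtain ⟨t1, t2⟩ := et'
  obtain ⟨x1, x2⟩ := ex'
  -- Subtracting `Λ₊(β)` times the first row from the second eliminates the `β` component; `hB`
  -- eliminates the `α` component with `Λ₋(α)`.
  have hA : vt.1 = -(Lp q.2 * vx.1) := by
    have e1 : (Lp q.2 - Lm q.1) * (1 / (Lp q.1 - Lm q.1) * vt.1) = -Lp q.2 := by
      linear_combination t2 - Lp q.2 * t1
    have e2 : (Lp q.2 - Lm q.1) * (1 / (Lp q.1 - Lm q.1) * vx.1) = 1 := by
      linear_combination x2 - Lp q.2 * x1
    refine mul_left_cancel₀ hgap (mul_left_cancel₀ (one_div_ne_zero gA) ?_)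
    linear_combination e1 + Lp q.2 * e2
  have hB : vt.2 = -(Lm q.1 * vx.2) := by
    have e1 : (Lp q.2 - Lm q.1) * (1 / (Lp q.2 - Lm q.2) * vt.2) = -Lm q.1 := by
      linear_combination t2 - Lm q.1 * t1
    have e2 : (Lp q.2 - Lm q.1) * (1 / (Lp q.2 - Lm q.2) * vx.2) = 1 := by
      linear_combination x2 - Lm q.1 * x1
    refine mul_left_cancel₀ hgap (mul_left_cancel₀ (one_div_ne_zero gB) ?_)
    linear_combination e1 + Lm q.1 * e2
  have hm := (S.contDiff_minus.differentiable one_ne_zero q.1).hasDerivAt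
  have hpl := (S.contDiff_plus.differentiable one_ne_zero q.2).hasDerivAt
  have hx1 : HasDerivAt (fun y => (charParam Lm Lp (t, y)).1) vx.1 x := by
    have h := (hasFDerivAt_fst (𝕜 := ℝ) (p := q)).comp_hasDerivAt x hpx
    exact h
  have hx2 : HasDerivAt (fun y => (charParam Lm Lp (t, y)).2) vx.2 x := by
    have h := (hasFDerivAt_snd (𝕜 := ℝ) (p := q)).comp_hasDerivAt x hpx
    exact h
  refine ⟨deriv Lm q.1 * vx.1, deriv Lp q.2 * vx.2, ?_, ?_, ?_, ?_⟩
  · refine (hm.comp t ((hasFDerivAt_fst (𝕜 := ℝ) (p := q)).comp_hasDerivAt t hp)).congr_deriv ?_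
    change deriv Lm q.1 * vt.1 = _
    rw [hA]; ring
  · exact hm.comp x hx1
  · refine (hpl.comp t ((hasFDerivAt_snd (𝕜 := ℝ) (p := q)).comp_hasDerivAt t hp)).congr_deriv ?_
    change deriv Lp q.2 * vt.2 = _
    rw [hB]; ring
  · exact hpl.comp x hx2

theorem contDiffOn_charDensity (μ : ℝ) : ContDiffOn ℝ 1 (charDensity μ Lm Lp) (openStrip T) := by
  have h := S.contDiffOn_charParam hT
  exact contDiffOn_const.div ((S.contDiff_plus.comp_contDiffOn (contDiff_snd.comp_contDiffOn h)).sub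
    (S.contDiff_minus.comp_contDiffOn (contDiff_fst.comp_contDiffOn h)))
    fun z hz => (S.charParam_gap_pos hT hz).ne'

theorem contDiffOn_charVelocity : ContDiffOn ℝ 1 (charVelocity Lm Lp) (openStrip T) := by
  have h := S.contDiffOn_charParam hT
  exact ((S.contDiff_plus.comp_contDiffOn (contDiff_snd.comp_contDiffOn h)).add
    (S.contDiff_minus.comp_contDiffOn (contDiff_fst.comp_contDiffOn h))).div_const 2

theorem isClassicalSolution {μ : ℝ} (hμ : 0 < μ) (p₀ : ℝ) {ρ₀ u₀ : ℝ → ℝ} (hT0 : 0 < T)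
    (hm : Lm = initMinus μ ρ₀ u₀) (hp : Lp = initPlus μ ρ₀ u₀) :
    IsClassicalSolution p₀ μ ρ₀ u₀ T (charDensity μ Lm Lp) (charVelocity Lm Lp) := by
  have hinit : ∀ x, charParam Lm Lp (0, x) = (x, x) := fun x =>
    S.charParam_eq hT ⟨le_rfl, hT0⟩ (by
      rw [S.charMap_eq]
      simp)
  refine ⟨fun z hz => div_pos (by positivity) (S.charParam_gap_pos hT hz),
    S.contDiffOn_charDensity hT μ, S.contDiffOn_charVelocity hT, fun x => ?_, fun x => ?_,
    fun t x h0 h1 => ?_, fun t x h0 h1 => ?_⟩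
  · rw [charDensity, hinit]
    have hg := S.gap_ne x
    rw [hm, hp] at hg ⊢
    simp only [initMinus, initPlus] at hg ⊢
    -- If `ρ₀ x = 0`, then `μ / ρ₀ x = 0` by convention and the gap would vanish.
    have hρ : ρ₀ x ≠ 0 := fun h => hg (by simp [h])
    rw [show u₀ x + μ / ρ₀ x - (u₀ x - μ / ρ₀ x) = 2 * μ / ρ₀ x by ring, div_div_cancel₀]
    positivity
  · rw [charVelocity, hinit, hm, hp]
    simp only [initMinus, initPlus]
    ring
  · obtain ⟨m, p, e1, e2, e3, e4⟩ := S.exists_invariant_deriv hT (x := x) h0 h1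
    exact mass_of_invariants (M := fun z => Lm (charParam Lm Lp z).1)
      (P := fun z => Lp (charParam Lm Lp z).2) e1 e2 e3 e4
      (S.charParam_gap_pos hT ⟨h0.le, h1⟩).ne'
  · obtain ⟨m, p, e1, e2, e3, e4⟩ := S.exists_invariant_deriv hT (x := x) h0 h1
    exact momentum_of_invariants (M := fun z => Lm (charParam Lm Lp z).1)
      (P := fun z => Lp (charParam Lm Lp z).2) e1 e2 e3 e4
      (S.charParam_gap_pos hT ⟨h0.le, h1⟩).ne'

end SeparatedInvariants

/-! ### From local integrability to negligibility -/

theorem square_eq_prod (t₀ x₀ ε : ℝ) :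
    square t₀ x₀ ε = Icc (t₀ - ε) (t₀ + ε) ×ˢ Icc (x₀ - ε) (x₀ + ε) := by
  ext z
  simp only [square, mem_ofPred_eq, mem_prod, mem_Icc, abs_le]
  constructor <;> rintro ⟨⟨h1, h2⟩, h3, h4⟩ <;> refine ⟨⟨?_, ?_⟩, ?_, ?_⟩ <;> linarith

theorem isCompact_square (t₀ x₀ ε : ℝ) : IsCompact (square t₀ x₀ ε) := by
  rw [square_eq_prod]
  exact isCompact_Icc.prod isCompact_Icc

theorem volume_square (t₀ x₀ ε : ℝ) :
    volume (square t₀ x₀ ε) = ENNReal.ofReal (2 * ε) * ENNReal.ofReal (2 * ε) := by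
  rw [square_eq_prod, Measure.volume_eq_prod, Measure.prod_prod, Real.volume_Icc, Real.volume_Icc]
  congr 2 <;> ring

theorem measurableSet_strip (T : ℝ) : MeasurableSet (strip T) :=
  (measurableSet_le measurable_const measurable_fst).inter
    (measurableSet_le measurable_fst measurable_const)

theorem measurableSet_openStrip (T : ℝ) : MeasurableSet (openStrip T) :=
  (measurableSet_le measurable_const measurable_fst).inter
    (measurableSet_lt measurable_fst measurable_const)

theorem volume_fst_eq (a : ℝ) : volume {z : ℝ × ℝ | z.1 = a} = 0 := by
  rw [show {z : ℝ × ℝ | z.1 = a} = {a} ×ˢ univ by ext; simp, Measure.volume_eq_prod,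
    Measure.prod_prod]
  simp

theorem integrableOn_strip_of_openStrip {f : ℝ × ℝ → ℝ} {s : Set (ℝ × ℝ)} {T : ℝ}
    (h : IntegrableOn f (s ∩ openStrip T)) : IntegrableOn f (s ∩ strip T) := by
  have h0 : IntegrableOn f {z : ℝ × ℝ | z.1 = T} := by
    rw [IntegrableOn, Measure.restrict_eq_zero.2 (volume_fst_eq T)]
    exact integrable_zero_measure
  refine (h.union h0).mono_set fun z hz => ?_
  rcases hz.2.2.lt_or_eq with hlt | heq
  · exact Or.inl ⟨hz.1, hz.2.1, hlt⟩
  · exact Or.inr heq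

/-- The one-sided derivative `fderivWithin` is continuous up to `t = 0`, hence bounded on compact
sets. The two-sided `partialT` is uncontrolled on that line, and agrees with it for `t > 0`. -/
theorem integrableOn_mul_deriv_testFunction {φ : ℝ × ℝ → ℝ} (hφ : IsTestFunction φ)
    {w : ℝ × ℝ → ℝ} {s : Set (ℝ × ℝ)} {T : ℝ} (hs : IsCompact s)
    (hw : IntegrableOn w (s ∩ strip T)) (v : ℝ × ℝ) :
    IntegrableOn (fun z => w z * fderivWithin ℝ φ {z | 0 ≤ z.1} z v) (s ∩ strip T) := by
  have hH : UniqueDiffOn ℝ {z : ℝ × ℝ | 0 ≤ z.1} := by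
    rw [show {z : ℝ × ℝ | 0 ≤ z.1} = Ici 0 ×ˢ univ by ext; simp]
    exact (uniqueDiffOn_Ici 0).prod uniqueDiffOn_univ
  have hc : ContinuousOn (fun z => fderivWithin ℝ φ {z : ℝ × ℝ | 0 ≤ z.1} z v) {z | 0 ≤ z.1} :=
    (hφ.1.continuousOn_fderivWithin hH le_rfl).clm_apply continuousOn_const
  have hm : MeasurableSet (s ∩ strip T) := hs.measurableSet.inter (measurableSet_strip T)
  have hsub : s ∩ strip T ⊆ s ∩ {z : ℝ × ℝ | 0 ≤ z.1} := fun z hz => ⟨hz.1, hz.2.1⟩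
  obtain ⟨C, hC⟩ := (hs.inter_right (isClosed_le continuous_const continuous_fst)
    ).exists_bound_of_continuousOn (hc.mono inter_subset_right)
  refine Integrable.mul_bdd (c := C) hw
    ((hc.mono (hsub.trans inter_subset_right)).aestronglyMeasurable hm) ?_
  filter_upwards [ae_restrict_mem hm] with z hz using hC z (hsub hz)

theorem partial_eq_fderivWithin {φ : ℝ × ℝ → ℝ} (hφ : IsTestFunction φ) {z : ℝ × ℝ}
    (hz : 0 < z.1) : partialT φ z = fderivWithin ℝ φ {z | 0 ≤ z.1} z (1, 0) ∧
      partialX φ z = fderivWithin ℝ φ {z | 0 ≤ z.1} z (0, 1) := by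
  have hn : {z : ℝ × ℝ | 0 ≤ z.1} ∈ 𝓝 z :=
    (continuous_fst.continuousAt.eventually (lt_mem_nhds hz)).mono fun w h => le_of_lt h
  have hd := ((hφ.1.contDiffAt hn).differentiableAt one_ne_zero).hasFDerivAt
  rw [fderivWithin_of_mem_nhds hn]
  exact ⟨(hd.comp_hasDerivAt z.1 (f := fun s => (s, z.2))
      ((hasDerivAt_id z.1).prodMk (hasDerivAt_const z.1 z.2))).deriv,
    (hd.comp_hasDerivAt z.2 (f := fun y => (z.1, y))
      ((hasDerivAt_const z.2 z.1).prodMk (hasDerivAt_id z.2))).deriv⟩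

/-- Integrability near the point suffices for negligibility there. -/
theorem negligibleAt_of_integrableOn {t₀ x₀ : ℝ} {w g : ℝ × ℝ → ℝ}
    (hw : ∀ ε, 0 < ε → IntegrableOn w (square t₀ x₀ ε ∩ strip t₀))
    (hg : ∀ ε, 0 < ε → IntegrableOn g (square t₀ x₀ ε ∩ strip t₀)) :
    NegligibleAt t₀ x₀ w g := by
  intro φ hφ
  have hint : ∀ ε : ℝ, 0 < ε → IntegrableOn (fun z => w z * partialT φ z + g z * partialX φ z)
      (square t₀ x₀ ε ∩ strip t₀) := by
    intro ε hε
    have hc := isCompact_square t₀ x₀ ε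
    have h := (integrableOn_mul_deriv_testFunction hφ hc (hw ε hε) (1, 0)).add
      (integrableOn_mul_deriv_testFunction hφ hc (hg ε hε) (0, 1))
    refine h.congr ?_
    -- The line `t = 0`, where the two derivatives may differ, is null.
    filter_upwards [ae_restrict_mem (hc.measurableSet.inter (measurableSet_strip t₀)),
      ae_restrict_of_ae (compl_mem_ae_iff.2 (volume_fst_eq 0))] with z hz h0
    obtain ⟨e1, e2⟩ := partial_eq_fderivWithin hφ (lt_of_le_of_ne hz.2.1 (Ne.symm h0))
    simp only [Pi.add_apply, e1, e2]
  refine ⟨hint, ?_⟩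
  have hvol : Tendsto (fun ε => volume (square t₀ x₀ ε ∩ strip t₀)) (𝓝[>] 0) (𝓝 0) := by
    have h1 : Tendsto (fun ε : ℝ => ENNReal.ofReal (2 * ε) * ENNReal.ofReal (2 * ε))
        (𝓝[>] 0) (𝓝 0) := by
      have h2 : Tendsto (fun ε : ℝ => ENNReal.ofReal ((2 * ε) * (2 * ε))) (𝓝[>] 0) (𝓝 0) := by
        have : Continuous fun ε : ℝ => ENNReal.ofReal ((2 * ε) * (2 * ε)) :=
          ENNReal.continuous_ofReal.comp (by fun_prop)
        simpa using (this.tendsto 0).mono_left nhdsWithin_le_nhds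
      refine h2.congr' ?_
      filter_upwards [self_mem_nhdsWithin] with ε hε
      rw [ENNReal.ofReal_mul (by have : 0 < ε := hε; positivity)]
    refine tendsto_of_tendsto_of_tendsto_of_le_of_le tendsto_const_nhds h1 (fun _ => zero_le)
      fun ε => ?_
    exact (measure_mono inter_subset_left).trans (volume_square t₀ x₀ ε).le
  have hvol' : Tendsto ((volume.restrict (square t₀ x₀ 1 ∩ strip t₀)) ∘
      fun ε => square t₀ x₀ ε ∩ strip t₀) (𝓝[>] 0) (𝓝 0) :=
    tendsto_of_tendsto_of_tendsto_of_le_of_le tendsto_const_nhds hvol (fun _ => zero_le)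
      fun ε => Measure.restrict_apply_le _ _
  -- Absolute continuity of the integral over the fixed region `ε = 1`, which contains all smaller
  -- ones.
  refine ((hint 1 one_pos).tendsto_setIntegral_nhds_zero hvol').congr' ?_
  filter_upwards [Ioo_mem_nhdsGT (zero_lt_one' ℝ)] with ε hε
  rw [Measure.restrict_restrict
    ((isCompact_square t₀ x₀ ε).measurableSet.inter (measurableSet_strip t₀)),
    inter_eq_self_of_subset_left]
  exact fun z hz => ⟨⟨hz.1.1.trans hε.2.le, hz.1.2.trans hε.2.le⟩, hz.2⟩

/-! ### Blowup of the density and integrability of the fluxes -/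

namespace SeparatedInvariants

variable {c K : ℝ} {Lm Lp : ℝ → ℝ}

theorem abs_charVelocity_le (S : SeparatedInvariants c K Lm Lp) (z : ℝ × ℝ) : |charVelocity Lm Lp z| ≤ K := by
  rw [charVelocity, abs_div, abs_two]
  have := abs_add_le (Lp (charParam Lm Lp z).2) (Lm (charParam Lm Lp z).1)
  linarith [S.bound_minus (charParam Lm Lp z).1, S.bound_plus (charParam Lm Lp z).2]

/-- The characteristic parameters of a bounded region of space-time are bounded. -/
theorem exists_compact_param (S : SeparatedInvariants c K Lm Lp) (T x₀ r : ℝ) :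
    ∃ B : Set (ℝ × ℝ), IsCompact B ∧ ∀ q : ℝ × ℝ, q.1 ≤ q.2 → charTime Lm Lp q.1 q.2 ≤ T →
      |charPos Lm Lp q.1 q.2 - x₀| ≤ r → q ∈ B := by
  have hK := S.bound_pos
  have hc := S.pos
  set A := (1 + 2 * K / c) * (2 * K * T) with hA
  -- `A` bounds the distance from `α` to the position, and `2KT` bounds `β - α`.
  refine ⟨Icc (x₀ - r - A) (x₀ + r + A) ×ˢ Icc (x₀ - r - A) (x₀ + r + A + 2 * K * T),
    isCompact_Icc.prod isCompact_Icc, fun q hq ht hx => ?_⟩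
  have h1 := S.sub_le_charTime hq
  have h2 : 2 * K * charTime Lm Lp q.1 q.2 ≤ 2 * K * T :=
    mul_le_mul_of_nonneg_left ht (by positivity)
  have h3 := abs_le.1 ((S.abs_charPos_sub_le hq).trans
    (mul_le_mul_of_nonneg_left h2 (by positivity)))
  rw [← hA] at h3
  have h4 := abs_le.1 hx
  refine ⟨⟨?_, ?_⟩, ?_, ?_⟩ <;> linarith

variable {T : ℝ} (S : SeparatedInvariants c K Lm Lp)
  (hT : ∀ q ∈ singularSet Lm Lp, T ≤ charTime Lm Lp q.1 q.2)
include S hT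

/-- Parameters in a compact set with gap at least `δ` have a compact image, which misses the blowup
point by `eq_of_charMap_eq`. Near that point the gap is therefore below `δ`. -/
theorem tendsto_charDensity_atTop {μ : ℝ} (hμ : 0 < μ) {q₀ : ℝ × ℝ}
    (hq₀ : q₀ ∈ singularSet Lm Lp) (ht : charTime Lm Lp q₀.1 q₀.2 = T) :
    Tendsto (charDensity μ Lm Lp) (𝓝[openStrip T] (charMap Lm Lp q₀)) atTop := by
  have hlim : Tendsto (fun z => Lp (charParam Lm Lp z).2 - Lm (charParam Lm Lp z).1)
      (𝓝[openStrip T] (charMap Lm Lp q₀)) (𝓝[>] 0) := by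
    refine tendsto_nhdsWithin_iff.2 ⟨tendsto_order.2 ⟨fun a ha => ?_, fun δ hδ => ?_⟩, ?_⟩
    · filter_upwards [self_mem_nhdsWithin] with z hz
      exact ha.trans (S.charParam_gap_pos hT hz)
    · obtain ⟨B, hB, hBmem⟩ := S.exists_compact_param T (charPos Lm Lp q₀.1 q₀.2) 1
      have hcont : Continuous fun q : ℝ × ℝ => Lp q.2 - Lm q.1 :=
        (S.contDiff_plus.continuous.comp continuous_snd).sub
          (S.contDiff_minus.continuous.comp continuous_fst)
      have hcpt : IsCompact (charMap Lm Lp '' (B ∩ {q | δ ≤ Lp q.2 - Lm q.1})) :=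
        (hB.inter_right (isClosed_le continuous_const hcont)).image S.contDiff_charMap.continuous
      have hnot : charMap Lm Lp q₀ ∉ charMap Lm Lp '' (B ∩ {q | δ ≤ Lp q.2 - Lm q.1}) := by
        rintro ⟨q, ⟨-, hq⟩, he⟩
        have h := S.eq_of_charMap_eq hT hq₀ ht he
        have hq' : δ ≤ Lp q.2 - Lm q.1 := hq
        rw [h, sub_self] at hq'
        exact hq'.not_gt hδ
      have hball : {z : ℝ × ℝ | |z.2 - charPos Lm Lp q₀.1 q₀.2| < 1} ∈ 𝓝 (charMap Lm Lp q₀) :=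
        (isOpen_lt (by fun_prop) continuous_const).mem_nhds (by simp [charMap])
      filter_upwards [self_mem_nhdsWithin, mem_nhdsWithin_of_mem_nhds hball,
        mem_nhdsWithin_of_mem_nhds (hcpt.isClosed.isOpen_compl.mem_nhds hnot)] with z hz hz1 hz2
      by_contra! hge
      obtain ⟨h1, h2⟩ := S.charParam_spec hT hz
      refine hz2 ⟨charParam Lm Lp z, ⟨hBmem _ h1 ?_ ?_, hge⟩, h2⟩
      · exact (congrArg Prod.fst h2).trans_le hz.2.le
      · rw [show charPos Lm Lp (charParam Lm Lp z).1 (charParam Lm Lp z).2 = z.2 from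
          congrArg Prod.snd h2]
        exact le_of_lt hz1
    · filter_upwards [self_mem_nhdsWithin] with z hz using S.charParam_gap_pos hT hz
  have h := (tendsto_inv_nhdsGT_zero.comp hlim).const_mul_atTop (show 0 < 2 * μ by positivity)
  exact h

/-- By the change of variables to characteristic parameters the density has a bounded integrand:
`ρ |∂(t, x) / ∂(α, β)|` is a product of the weights at `α` and at `β`. -/
theorem integrableOn_charDensity (μ x₀ ε : ℝ) :
    IntegrableOn (charDensity μ Lm Lp) (square T x₀ ε ∩ openStrip T) := by
  set D := square T x₀ ε ∩ openStrip T with hD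
  have hDm : MeasurableSet D :=
    (isCompact_square T x₀ ε).measurableSet.inter (measurableSet_openStrip T)
  have hcont := S.contDiff_charMap.continuous
  have himage : charMap Lm Lp '' (charMap Lm Lp ⁻¹' D) = D :=
    image_preimage_eq_of_subset fun z hz => ⟨_, (S.charParam_spec hT hz.2).2⟩
  have hinj : InjOn (charMap Lm Lp) (charMap Lm Lp ⁻¹' D) := fun q hq q' hq' h => by
    rw [← S.charParam_eq hT hq.2 rfl, ← S.charParam_eq hT hq'.2 rfl, h]
  have hsm : MeasurableSet (charMap Lm Lp ⁻¹' D) := hcont.measurable hDm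
  rw [← himage, integrableOn_image_iff_integrableOn_abs_det_fderiv_smul volume hsm
    (fun q _ => (S.hasFDerivAt_charMap q).hasFDerivWithinAt) hinj]
  obtain ⟨B, hB, hBmem⟩ := S.exists_compact_param T x₀ ε
  have hsub : charMap Lm Lp ⁻¹' D ⊆ B := fun q hq =>
    hBmem q (S.charTime_nonneg_iff.1 hq.2.1) hq.2.2.le hq.1.2
  have hw : Continuous fun q : ℝ × ℝ =>
      2 * μ * (1 / (Lp q.1 - Lm q.1) * (1 / (Lp q.2 - Lm q.2))) :=
    continuous_const.mul ((S.continuous_weight.comp continuous_fst).mul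
      (S.continuous_weight.comp continuous_snd))
  refine ((hw.continuousOn.integrableOn_compact hB).mono_set hsub).congr_fun (fun q hq => ?_) hsm
  have hpar := S.charParam_eq hT hq.2 rfl
  have hgap := S.charParam_gap_pos hT hq.2
  have hweight : 0 < 1 / (Lp q.1 - Lm q.1) * (1 / (Lp q.2 - Lm q.2)) :=
    mul_pos (one_div_pos.2 (S.gap_pos _)) (one_div_pos.2 (S.gap_pos _))
  rw [hpar] at hgap
  simp only [charDensity, hpar, det_charJacobian, abs_neg, smul_eq_mul]
  rw [abs_of_pos (mul_pos hgap hweight)]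
  field_simp

/-- The velocity is bounded by `K`, and the pressure `p₀ - μ (λ₊ - λ₋) / 2` by `|p₀| + μ K`, so
integrability of `ρ` suffices. -/
theorem integrableOn_fluxes {μ : ℝ} (hμ : 0 < μ) (p₀ x₀ ε : ℝ) :
    IntegrableOn (fun z => charDensity μ Lm Lp z * charVelocity Lm Lp z)
      (square T x₀ ε ∩ openStrip T) ∧
    IntegrableOn (fun z => charDensity μ Lm Lp z * charVelocity Lm Lp z ^ 2 +
      pressure p₀ μ (charDensity μ Lm Lp z)) (square T x₀ ε ∩ openStrip T) := by
  have hDm : MeasurableSet (square T x₀ ε ∩ openStrip T) :=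
    (isCompact_square T x₀ ε).measurableSet.inter (measurableSet_openStrip T)
  have hρ := S.integrableOn_charDensity hT μ x₀ ε
  have hu := (S.contDiffOn_charVelocity hT).continuousOn.mono
    (inter_subset_right (s := square T x₀ ε))
  have hd := (S.contDiffOn_charDensity hT μ).continuousOn.mono
    (inter_subset_right (s := square T x₀ ε))
  refine ⟨Integrable.mul_bdd (c := K) hρ (hu.aestronglyMeasurable hDm)
    (Eventually.of_forall (S.abs_charVelocity_le)), ?_⟩
  refine Integrable.add (Integrable.mul_bdd (c := K ^ 2) hρ
    ((hu.pow 2).aestronglyMeasurable hDm) (Eventually.of_forall fun z => ?_)) ?_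
  · rw [norm_pow]
    exact pow_le_pow_left₀ (norm_nonneg _) (S.abs_charVelocity_le z) 2
  · have hpos : ∀ z ∈ square T x₀ ε ∩ openStrip T, charDensity μ Lm Lp z ≠ 0 := fun z hz =>
      (div_pos (by positivity) (S.charParam_gap_pos hT hz.2)).ne'
    have hfin : volume (square T x₀ ε ∩ openStrip T) ≠ ⊤ :=
      ((measure_mono inter_subset_left).trans_lt (isCompact_square T x₀ ε).measure_lt_top).ne
    refine Integrable.mono' (g := fun _ => |p₀| + μ * K) (integrableOn_const hfin)
      ((continuousOn_const.sub (continuousOn_const.div hd hpos)).aestronglyMeasurable hDm)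
      (Eventually.of_forall fun z => ?_)
    rw [Real.norm_eq_abs, pressure, charDensity, div_div_eq_mul_div,
      show μ ^ 2 * (Lp (charParam Lm Lp z).2 - Lm (charParam Lm Lp z).1) / (2 * μ) =
        μ * ((Lp (charParam Lm Lp z).2 - Lm (charParam Lm Lp z).1) / 2) by field_simp]
    refine (abs_sub _ _).trans (add_le_add_right ?_ _)
    rw [abs_mul, abs_of_pos hμ, abs_div, abs_two]
    refine mul_le_mul_of_nonneg_left ?_ hμ.le
    have := abs_sub (Lp (charParam Lm Lp z).2) (Lm (charParam Lm Lp z).1)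
    linarith [S.bound_minus (charParam Lm Lp z).1, S.bound_plus (charParam Lm Lp z).2]

end SeparatedInvariants

/-! ### Separation of the initial invariants and conclusion -/

/-- Strictly ordered decreasing invariants coming from bounded `C²` data are separated. -/
theorem exists_separatedInvariants {μ : ℝ} (hμ : 0 < μ) {ρ₀ u₀ : ℝ → ℝ} (hρ₀ : BoundedC2 ρ₀)
    (hu₀ : BoundedC2 u₀) (hlt : ∀ x, initMinus μ ρ₀ u₀ x < initPlus μ ρ₀ u₀ x)
    (hanti : ∀ x, deriv (initMinus μ ρ₀ u₀) x < 0 ∧ deriv (initPlus μ ρ₀ u₀) x < 0) :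
    ∃ c K, SeparatedInvariants c K (initMinus μ ρ₀ u₀) (initPlus μ ρ₀ u₀) := by
  have hpos : ∀ x, 0 < ρ₀ x := fun x => by
    have h := hlt x
    simp only [initMinus, initPlus] at h
    have h2 : 0 < μ / ρ₀ x := by linarith
    exact (div_pos_iff_of_pos_left hμ).1 h2
  obtain ⟨hρ, C, hC⟩ := hρ₀
  obtain ⟨hu, C', hC'⟩ := hu₀
  have hCρ : ∀ x, ρ₀ x ≤ C := fun x => (le_abs_self _).trans (by simpa using hC 0 (by simp) x)
  have hCu : ∀ x, |u₀ x| ≤ C' := fun x => by simpa using hC' 0 (by simp) x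
  have hquot : ContDiff ℝ 1 fun x => μ / ρ₀ x :=
    contDiff_const.div (hρ.of_le one_le_two) fun x => (hpos x).ne'
  have hbd := abs_le_of_antitone_of_mean_bounded (C := C')
    (strictAnti_of_deriv_neg fun x => (hanti x).1).antitone
    (strictAnti_of_deriv_neg fun x => (hanti x).2).antitone hlt
    (fun x => by
      rw [show (initPlus μ ρ₀ u₀ x + initMinus μ ρ₀ u₀ x) / 2 = u₀ x by
        simp only [initPlus, initMinus]; ring]
      exact hCu x)
  have hC0 : 0 < C := (hpos 0).trans_le (hCρ 0)
  -- The gap is `2μ / ρ₀`, and `ρ₀ ≤ C`.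
  refine ⟨2 * (μ / C), _, (hu.of_le one_le_two).sub hquot, (hu.of_le one_le_two).add hquot,
    by positivity, fun x => ?_, fun x => (hbd x).1, fun x => (hbd x).2⟩
  have h := div_le_div_of_nonneg_left hμ.le (hpos x) (hCρ x)
  simp only [initPlus, initMinus]
  linarith

end Chaplygin

theorem theorem5p1
    (μ p₀ : ℝ) (hμ : 0 < μ) (hp₀ : 0 < p₀)
    (ρ₀ u₀ : ℝ → ℝ) (hρ₀ : BoundedC2 ρ₀) (hu₀ : BoundedC2 u₀)
    (Lm Lp : ℝ → ℝ) (hLm : Lm = initMinus μ ρ₀ u₀) (hLp : Lp = initPlus μ ρ₀ u₀)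
    (H1 : ∀ x : ℝ, Lm x < Lp x)
    (H2 : ∀ x : ℝ, deriv Lm x < 0 ∧ deriv Lp x < 0)
    (α₀ β₀ : ℝ) (H3 : (α₀, β₀) ∈ singularSet Lm Lp)
    (H4 : cuspFun Lm Lp α₀ = 0)
    (H5 : deriv (cuspFun Lm Lp) α₀ < 0)
    (t₀ x₀ : ℝ) (ht₀ : t₀ = charTime Lm Lp α₀ β₀) (hx₀ : x₀ = charPos Lm Lp α₀ β₀)
    (hfirst : ∀ q ∈ singularSet Lm Lp, t₀ ≤ charTime Lm Lp q.1 q.2)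
    (ρ u : ℝ × ℝ → ℝ) (hρ : ρ = charDensity μ Lm Lp) (hu : u = charVelocity Lm Lp) :
    -- characteristic parameters are well defined before the blowup time
    (∀ z ∈ openStrip t₀, ∃! q : ℝ × ℝ, q.1 ≤ q.2 ∧ charMap Lm Lp q = z) ∧
    -- the construction gives the classical solution, which blows up at `(t₀, x₀)`
    IsClassicalSolution p₀ μ ρ₀ u₀ t₀ ρ u ∧
    Tendsto ρ (𝓝[openStrip t₀] (t₀, x₀)) atTop ∧
    -- both equations satisfy the limit condition at the blowup point
    NegligibleAt t₀ x₀ ρ (fun z => ρ z * u z) ∧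
    NegligibleAt t₀ x₀ (fun z => ρ z * u z)
      (fun z => ρ z * u z ^ 2 + pressure p₀ μ (ρ z)) := by
  subst hρ hu ht₀ hx₀
  obtain ⟨c, K, S⟩ : ∃ c K, SeparatedInvariants c K Lm Lp := by
    rw [hLm, hLp] at H1 H2 ⊢
    exact exists_separatedInvariants hμ hρ₀ hu₀ H1 H2
  have hpos : 0 < charTime Lm Lp α₀ β₀ := by
    rw [← charTime_self Lm Lp α₀]
    exact S.charTime_lt_charTime H3.1
  have hρint : ∀ ε, 0 < ε → IntegrableOn (charDensity μ Lm Lp)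
      (square (charTime Lm Lp α₀ β₀) (charPos Lm Lp α₀ β₀) ε ∩ strip (charTime Lm Lp α₀ β₀)) :=
    fun ε _ => integrableOn_strip_of_openStrip (S.integrableOn_charDensity hfirst μ _ ε)
  have hflux := fun ε => S.integrableOn_fluxes hfirst hμ p₀ (charPos Lm Lp α₀ β₀) ε
  exact ⟨fun z hz => S.existsUnique_param hfirst hz,
    S.isClassicalSolution hfirst hμ p₀ hpos hLm hLp,
    S.tendsto_charDensity_atTop hfirst hμ H3 rfl,
    negligibleAt_of_integrableOn hρint fun ε _ => integrableOn_strip_of_openStrip (hflux ε).1,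
    negligibleAt_of_integrableOn (fun ε _ => integrableOn_strip_of_openStrip (hflux ε).1)
      fun ε _ => integrableOn_strip_of_openStrip (hflux ε).2⟩
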